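/- Conventions. For each $n\ge 0$ let $I_n(3412)$ be the set of involutions $\pi$ of $\{1,\dots,n\}$ with no subsequence order-isomorphic to $3412$, and let $I(3412)=\bigcup_{n\ge0}I_n(3412)$ (including the empty permutation). Write $|\pi|$ for the length of $\pi$, $\mathrm{sign}(\pi)\in\{1,-1\}$ for its sign, $\tau_k(\pi)$ for the number of decreasing subsequences of $\pi$ of length $k$, $\mathrm{inv}(\pi)$ for the number of inversions, $\mathrm{lrmax}(\pi)$ and $\mathrm{rlmin}(\pi)$ for the numbers of left-to-right maxima and right-to-left minima, and $\mathrm{fix}(\pi)$ for the number of fixed points. All identities are between formal power series over $\mathbb{Q}$. An infinite continued fraction $\cfrac{a_0}{b_0+\cfrac{a_1}{b_1+\cdots}}$ denotes the coefficientwise limit of its finite convergents $\cfrac{a_0}{b_0+\cdots+\cfrac{a_N}{b_N}}$ (in each of which every denominator is invertible), and the square root of a series with constant term $1$ is the one with constant term $1$. Proposition. Let $x_1,x_2,\dots$ be indeterminates. The series $$C^-(\mathbf{x})=\sum_{\pi\in I(3412)}\mathrm{sign}(\pi)\prod_{k\ge1}x_k^{\tau_k(\pi)}$$ is well defined (each monomial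 occurs for finitely many $\pi$) and $$C^-(\mathbf{x})=\cfrac{1}{1-x_1+\cfrac{x_1^2x_2}{1-x_1x_2^2x_3+\cfrac{x_1^2x_2^5x_3^4x_4}{1-x_1x_2^4x_3^6x_4^4x_5+\cdots}}},$$ where for $n\ge1$ the $n$th numerator is $\prod_{i=1}^{2n}x_i^{\binom{2n-2}{i-1}+\binom{2n-1}{i-1}}$ and the $n$th denominator, the one below the $n$th numerator, is $1-\prod_{i=1}^{2n+1}x_i^{\binom{2n}{i-1}}$. Moreover, in the indeterminates $x,q$, the following series are well defined and satisfy: (1) $$\sum_{\pi\in I(3412)}\mathrm{sign}(\pi)q^{\mathrm{inv}(\pi)}x^{|\pi|}=\cfrac{1}{1-x+\cfrac{x^2q}{1-xq^2+\cfrac{x^2q^5}{1-xq^4+\cdots}}},$$ where for $n\ge1$ the $n$th numerator is $x^2q^{4n-3}$ and the $n$th denominator is $1-xq^{2n}$. (2) $$\sum_{\pi\in I(3412)}\mathrm{sign}(\pi)q^{\mathrm{lrmax}(\pi)}x^{|\pi|}=\sum_{\pi\in I(3412)}\mathrm{sign}(\pi)q^{\mathrm{rlmin}(\pi)}x^{|\pi|}=\cfrac{1}{1-xq+\cfrac{x^2q}{1-x+\cfrac{x^2}{1-x+\cfrac{x^2}{1-x+\cdots}}}}=\frac{2}{2-q-qx+q\sqrt{1-2x+5x^2}}.$$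 (3) $$\sum_{\pi\in I(3412)}\mathrm{sign}(\pi)q^{\mathrm{fix}(\pi)}x^{|\pi|}=\cfrac{1}{1-xq+\cfrac{x^2}{1-xq+\cfrac{x^2}{1-xq+\cdots}}}=\frac{-1+xq+\sqrt{1-2xq+x^2q^2+4x^2}}{2x^2},$$ the last equality meaning that $2x^2$ times the series equals the numerator on the right. -/

import Mathlib

open Filter

noncomputable section

/-! ### Permutations and patterns -/

/-- A permutation of arbitrary length `n ≥ 0`.  Positions and values are the elements
`0, …, n - 1` of `Fin n` in place of `1, …, n`. -/
abbrev AnyPerm : Type := Σ n : ℕ, Equiv.Perm (Fin n)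

/-- The occurrences of the pattern `σ` in `π`: the subsequences of `π`, given by strictly
increasing sequences of positions, with the same pairwise comparisons as `σ`. -/
def occurrences {n k : ℕ} (π : Equiv.Perm (Fin n)) (σ : Equiv.Perm (Fin k)) :
    Finset (Fin k → Fin n) :=
  Finset.univ.filter fun f =>
    (∀ i j, i < j → f i < f j) ∧ ∀ i j, π (f i) < π (f j) ↔ σ i < σ j

def Avoids {n k : ℕ} (π : Equiv.Perm (Fin n)) (σ : Equiv.Perm (Fin k)) : Prop :=
  occurrences π σ = ∅

/-- The permutation `3412`. -/
def pattern3412 : Equiv.Perm (Fin 4) :=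
  ⟨![2, 3, 0, 1], ![2, 3, 0, 1], by decide, by decide⟩

/-- `tau k π` is the number of subsequences of `π` of type `k … 2 1`. -/
def tau (k : ℕ) {n : ℕ} (π : Equiv.Perm (Fin n)) : ℕ :=
  (occurrences π (Fin.revPerm : Equiv.Perm (Fin k))).card

/-- Decreasing subsequences cannot be longer than the permutation. -/
theorem tau_eq_zero {k n : ℕ} (π : Equiv.Perm (Fin n)) (h : n < k) : tau k π = 0 := by
  unfold tau occurrences
  rw [Finset.card_eq_zero, Finset.filter_eq_empty_iff]
  rintro f - ⟨hf, -⟩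
  have hm : StrictMono f := fun i j hij => hf i j hij
  have := Fintype.card_le_of_injective f hm.injective
  simp only [Fintype.card_fin] at this
  omega

/-- The set of all involutions, of any length, that avoid `3412`. -/
def I3412 : Set AnyPerm :=
  {π | (∀ i, π.2 (π.2 i) = i) ∧ Avoids π.2 pattern3412}

/-- The number of inversions. -/
def numInv {n : ℕ} (π : Equiv.Perm (Fin n)) : ℕ :=
  (Finset.univ.filter fun p : Fin n × Fin n => p.1 < p.2 ∧ π p.2 < π p.1).card

/-- The number of left-to-right maxima. -/
def lrmax {n : ℕ} (π : Equiv.Perm (Fin n)) : ℕ :=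
  (Finset.univ.filter fun i : Fin n => ∀ j, j < i → π j < π i).card

/-- The number of right-to-left minima. -/
def rlmin {n : ℕ} (π : Equiv.Perm (Fin n)) : ℕ :=
  (Finset.univ.filter fun i : Fin n => ∀ j, i < j → π i < π j).card

/-- The number of fixed points. -/
def numFix {n : ℕ} (π : Equiv.Perm (Fin n)) : ℕ :=
  (Finset.univ.filter fun i : Fin n => π i = i).card

/-! ### Formal sums, continued fractions and square roots -/

/-- A family of formal power series is summable when each monomial occurs in only finitely many
members of the family. -/
def FormallySummable {σ ι : Type*} (f : ι → MvPowerSeries σ ℚ) : Prop :=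
  ∀ d : σ →₀ ℕ, {i | MvPowerSeries.coeff d (f i) ≠ 0}.Finite

/-- The sum of a summable family of formal power series, taken coefficient by coefficient. -/
def formalSum {σ ι : Type*} (f : ι → MvPowerSeries σ ℚ) : MvPowerSeries σ ℚ :=
  fun d => ∑ᶠ i, MvPowerSeries.coeff d (f i)

/-- The finite continued fraction denominator
`b k + a (k+1) / (b (k+1) + a (k+2) / (⋯ + a (k+N) / b (k+N)))`. -/
def cfDenom {σ : Type*} (a b : ℕ → MvPowerSeries σ ℚ) : ℕ → ℕ → MvPowerSeries σ ℚ
  | 0, k => b k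
  | N + 1, k => b k + a (k + 1) * (cfDenom a b N (k + 1))⁻¹

/-- The convergent `a 0 / (b 0 + a 1 / (b 1 + a 2 / (⋯ + a N / b N)))`. -/
def convergent {σ : Type*} (a b : ℕ → MvPowerSeries σ ℚ) (N : ℕ) : MvPowerSeries σ ℚ :=
  a 0 * (cfDenom a b N 0)⁻¹

/-- `F` is the value of the infinite continued fraction
`a 0 / (b 0 + a 1 / (b 1 + a 2 / (b 2 + ⋯)))`: every denominator that occurs in a convergent is
invertible, and every coefficient of the convergents is eventually that of `F`. -/
def IsContFrac {σ : Type*} (a b : ℕ → MvPowerSeries σ ℚ) (F : MvPowerSeries σ ℚ) : Prop :=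
  (∀ N k, IsUnit (cfDenom a b N k)) ∧
    ∀ d : σ →₀ ℕ, ∀ᶠ N in atTop,
      MvPowerSeries.coeff d (convergent a b N) = MvPowerSeries.coeff d F

/-- `S = √A` as formal power series, where `A` has constant term `1`. -/
def IsFormalSqrt {σ : Type*} (A S : MvPowerSeries σ ℚ) : Prop :=
  MvPowerSeries.constantCoeff S = 1 ∧ S ^ 2 = A

theorem IsFormalSqrt.unique {σ : Type*} {A S T : MvPowerSeries σ ℚ}
    (hS : IsFormalSqrt A S) (hT : IsFormalSqrt A T) : S = T := by
  rcases sq_eq_sq_iff_eq_or_eq_neg.mp (hS.2.trans hT.2.symm) with h | h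
  · exact h
  · have h1 := congrArg MvPowerSeries.constantCoeff h
    rw [map_neg, hS.1, hT.1] at h1
    norm_num at h1

/-! ### The signed generating functions -/

/-- The sign of a permutation, as a constant power series. -/
def signSeries {σ : Type*} {n : ℕ} (π : Equiv.Perm (Fin n)) : MvPowerSeries σ ℚ :=
  MvPowerSeries.C (((Equiv.Perm.sign π : ℤˣ) : ℤ) : ℚ)

/-- The term `sign(π) ∏_{k ≥ 1} x_k ^ τ_k(π)`, where `x_k` is `MvPowerSeries.X k`.  The variable
with index `0` is never used, and factors with `k` larger than the length of `π` are `1` by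
`tau_eq_zero`. -/
def tauTerm (π : I3412) : MvPowerSeries ℕ ℚ :=
  signSeries π.1.2 * ∏ k ∈ Finset.Icc 1 π.1.1, MvPowerSeries.X k ^ tau k π.1.2

/-- The indeterminate `x` of the two-variable generating functions. -/
abbrev xVar : MvPowerSeries (Fin 2) ℚ := MvPowerSeries.X 0

/-- The indeterminate `q` of the two-variable generating functions. -/
abbrev qVar : MvPowerSeries (Fin 2) ℚ := MvPowerSeries.X 1

/-- The term `sign(π) q ^ stat(π) x ^ |π|`. -/
def statTerm (stat : ∀ {n : ℕ}, Equiv.Perm (Fin n) → ℕ) (π : I3412) :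
    MvPowerSeries (Fin 2) ℚ :=
  signSeries π.1.2 * qVar ^ stat π.1.2 * xVar ^ π.1.1

end

/-!
Everything rests on the decomposition `assembleEquiv` of the involutions that avoid `3412`. If `π`
is a nonempty involution with `π 0 = k`, then an inner position `i` of `[0, k]` with `π i > k`
would give the occurrence of `3412` at `0 < i < k < π i`; so `π` maps `[0, k]` to itself and
exchanges its ends. Hence `π` is empty, or `1 ⊕ ρ`, or `wrap α ⊕ ρ`, where `α` and `ρ` are again
involutions that avoid `3412` and `wrap α` surrounds `α` by a new maximum in front and a new
minimum at the end. Conversely, `3412` is sum-indecomposable and neither begins with its maximum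
nor ends with its minimum, so all these permutations avoid `3412`.

The sign is multiplicative on direct sums and changes under `wrap`. Suppose that the weight `f` is
multiplied by `a` when a fixed point is put in front, and that `f (wrap α ⊕ ρ) = -b g(α) f(ρ)` for
a second weight `g`. Then the formal sums `F` and `G` satisfy `F (1 - a + b G) = 1`
(`formalSum_functional_equation`), which is one level of a continued fraction. A sequence of
series linked by such equations converges to the continued fraction, since truncating after `N`
levels causes an error of order greater than `N` (`isContFrac_of_recurrence`).

For the numbers `τ_k`, decreasing subsequences are the cliques of the inversion graph. A direct
sum of permutations gives a disjoint union of graphs, and `wrap` adds two apices in succession;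
adding one apex turns `τ_k` into `τ_k + τ_{k-1}`. On the weights `y_k` this is the substitution
`y_k ↦ y_k y_{k+1}`, whose iterates have binomial exponents, and each level of the continued
fraction applies it twice (`isContFrac_tauWeight`). The number of inversions is `τ_2`, so that its
series is a specialization. Left-to-right maxima, right-to-left minima and fixed points are
additive on direct sums; on `wrap α` the first two are `1` and the last is that of `α`. This gives
quadratic equations, whose solutions are the closed forms.
-/

/-! ### Formal sums -/

section FormalSums

variable {σ ι κ : Type*}

theorem coeff_formalSum (f : ι → MvPowerSeries σ ℚ) (d : σ →₀ ℕ) :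
    MvPowerSeries.coeff d (formalSum f) = ∑ᶠ i, MvPowerSeries.coeff d (f i) := rfl

theorem FormallySummable.comp_injective {f : ι → MvPowerSeries σ ℚ} (hf : FormallySummable f)
    {g : κ → ι} (hg : g.Injective) : FormallySummable (fun k => f (g k)) :=
  fun d => (hf d).preimage hg.injOn

/-- Only finitely many members of a summable family contribute to the coefficients of the monomials
that divide `d`. -/
theorem FormallySummable.exists_finset {f : ι → MvPowerSeries σ ℚ} (hf : FormallySummable f)
    (d : σ →₀ ℕ) :
    ∃ s : Finset ι, ∀ e ≤ d, ∀ i, MvPowerSeries.coeff e (f i) ≠ 0 → i ∈ s := by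
  classical
  have h : (⋃ e ∈ Finset.Iic d, {i | MvPowerSeries.coeff e (f i) ≠ 0}).Finite :=
    (Finset.Iic d).finite_toSet.biUnion (fun e _ => hf e)
  refine ⟨h.toFinset, fun e he i hi => ?_⟩
  rw [Set.Finite.mem_toFinset]
  exact Set.mem_biUnion (Finset.mem_Iic.2 he) hi

theorem antidiagonal_fst_le [DecidableEq σ] {d : σ →₀ ℕ} {e : (σ →₀ ℕ) × (σ →₀ ℕ)}
    (he : e ∈ Finset.HasAntidiagonal.antidiagonal d) : e.1 ≤ d :=
  le_self_add.trans_eq (Finset.HasAntidiagonal.mem_antidiagonal.1 he)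

theorem antidiagonal_snd_le [DecidableEq σ] {d : σ →₀ ℕ} {e : (σ →₀ ℕ) × (σ →₀ ℕ)}
    (he : e ∈ Finset.HasAntidiagonal.antidiagonal d) : e.2 ≤ d :=
  le_add_self.trans_eq (Finset.HasAntidiagonal.mem_antidiagonal.1 he)

theorem FormallySummable.mul {f : ι → MvPowerSeries σ ℚ} {g : κ → MvPowerSeries σ ℚ}
    (hf : FormallySummable f) (hg : FormallySummable g) :
    FormallySummable (fun p : ι × κ => f p.1 * g p.2) := by
  classical
  intro d
  obtain ⟨s, hs⟩ := hf.exists_finset d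
  obtain ⟨t, ht⟩ := hg.exists_finset d
  refine (s ×ˢ t).finite_toSet.subset fun p hp => ?_
  rw [Set.mem_ofPred_eq, MvPowerSeries.coeff_mul] at hp
  obtain ⟨e, he, hne⟩ := Finset.exists_ne_zero_of_sum_ne_zero hp
  exact Finset.mem_coe.2 (Finset.mem_product.2
    ⟨hs _ (antidiagonal_fst_le he) _ (left_ne_zero_of_mul hne),
      ht _ (antidiagonal_snd_le he) _ (right_ne_zero_of_mul hne)⟩)

theorem formalSum_mul {f : ι → MvPowerSeries σ ℚ} {g : κ → MvPowerSeries σ ℚ}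
    (hf : FormallySummable f) (hg : FormallySummable g) :
    formalSum (fun p : ι × κ => f p.1 * g p.2) = formalSum f * formalSum g := by
  classical
  ext d
  obtain ⟨s, hs⟩ := hf.exists_finset d
  obtain ⟨t, ht⟩ := hg.exists_finset d
  have h1 : ∀ e ≤ d, MvPowerSeries.coeff e (formalSum f)
      = ∑ i ∈ s, MvPowerSeries.coeff e (f i) := fun e he =>
    finsum_eq_sum_of_support_subset _ fun i hi => hs e he i hi
  have h2 : ∀ e ≤ d, MvPowerSeries.coeff e (formalSum g)
      = ∑ i ∈ t, MvPowerSeries.coeff e (g i) := fun e he =>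
    finsum_eq_sum_of_support_subset _ fun i hi => ht e he i hi
  rw [coeff_formalSum, finsum_eq_sum_of_support_subset (s := s ×ˢ t), Finset.sum_product,
    MvPowerSeries.coeff_mul]
  · simp only [MvPowerSeries.coeff_mul]
    rw [Finset.sum_congr rfl fun i _ => Finset.sum_comm, Finset.sum_comm]
    refine Finset.sum_congr rfl fun e he => ?_
    rw [h1 _ (antidiagonal_fst_le he), h2 _ (antidiagonal_snd_le he), Finset.sum_mul_sum]
  · intro p hp
    rw [Function.mem_support, MvPowerSeries.coeff_mul] at hp
    obtain ⟨e, he, hne⟩ := Finset.exists_ne_zero_of_sum_ne_zero hp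
    exact Finset.mem_coe.2 (Finset.mem_product.2
      ⟨hs _ (antidiagonal_fst_le he) _ (left_ne_zero_of_mul hne),
        ht _ (antidiagonal_snd_le he) _ (right_ne_zero_of_mul hne)⟩)

theorem formalSum_const_mul {f : ι → MvPowerSeries σ ℚ} (hf : FormallySummable f)
    (a : MvPowerSeries σ ℚ) : formalSum (fun i => a * f i) = a * formalSum f := by
  have ha : FormallySummable (fun _ : Unit => a) := fun _ => Set.toFinite _
  have hsum : formalSum (fun _ : Unit => a) = a := by
    ext d
    exact finsum_unique _
  rw [← hsum, ← formalSum_mul ha hf]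
  ext d
  rw [hsum, coeff_formalSum, coeff_formalSum, ← finsum_comp_equiv (Equiv.punitProd ι)]
  rfl

theorem formalSum_comp_equiv (e : κ ≃ ι) (f : ι → MvPowerSeries σ ℚ) :
    formalSum (fun k => f (e k)) = formalSum f := by
  ext d
  rw [coeff_formalSum, coeff_formalSum, ← finsum_comp_equiv e]

theorem formalSum_option {f : Option ι → MvPowerSeries σ ℚ} (hf : FormallySummable f) :
    formalSum f = f none + formalSum (fun i => f (some i)) := by
  ext d
  rw [map_add, coeff_formalSum, coeff_formalSum, finsum_option]
  exact hf.comp_injective (Option.some_injective ι) d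

theorem formalSum_sum {f : ι ⊕ κ → MvPowerSeries σ ℚ} (hf : FormallySummable f) :
    formalSum f = formalSum (fun i => f (Sum.inl i)) + formalSum (fun k => f (Sum.inr k)) := by
  classical
  ext d
  rw [map_add, coeff_formalSum, coeff_formalSum, coeff_formalSum]
  have hl := hf.comp_injective Sum.inl_injective d
  have hr := hf.comp_injective Sum.inr_injective d
  rw [finsum_eq_sum_of_support_subset (s := hl.toFinset.disjSum hr.toFinset),
    Finset.sum_disjSum, finsum_eq_sum_of_support_subset (s := hl.toFinset),
    finsum_eq_sum_of_support_subset (s := hr.toFinset)]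
  · intro i hi
    simpa using hi
  · intro i hi
    simpa using hi
  · rintro (i | i) hi <;> simpa using hi

end FormalSums

/-! ### Continued fractions from functional equations -/

section ContinuedFractions

variable {σ : Type*}

/-- If `F n = 1 / (b n + a (n + 1) * F (n + 1))` for all `n`, where the `a (n + 1)` have no constant
term, then `F 0` is the value of the continued fraction: replacing the tail `F (N + 1)` by
`0` multiplies the error by one of the `a`'s at each of the `N + 1` levels, so that it has order at
least `N + 1`. -/
theorem isContFrac_of_recurrence {a b F : ℕ → MvPowerSeries σ ℚ} (ha0 : a 0 = 1)
    (ha : ∀ n, MvPowerSeries.constantCoeff (a (n + 1)) = 0)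
    (hb : ∀ n, MvPowerSeries.constantCoeff (b n) = 1)
    (hF : ∀ n, F n * (b n + a (n + 1) * F (n + 1)) = 1) : IsContFrac a b (F 0) := by
  have hc : ∀ N k, MvPowerSeries.constantCoeff (cfDenom a b N k) = 1 := by
    intro N
    cases N with
    | zero => exact hb
    | succ N => intro k; simp [cfDenom, ha, hb]
  have hinv : ∀ N k, cfDenom a b N k * (cfDenom a b N k)⁻¹ = 1 := fun N k =>
    MvPowerSeries.mul_inv_cancel _ (by rw [hc]; exact one_ne_zero)
  have hmul : ∀ {m : ℕ} (f g : MvPowerSeries σ ℚ), (m : ℕ∞) ≤ f.order →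
      (m : ℕ∞) ≤ (f * g).order := fun f g h =>
    (h.trans le_self_add).trans MvPowerSeries.le_order_mul
  have hord : ∀ N k, ((N + 1 : ℕ) : ℕ∞) ≤
      (cfDenom a b N k - (b k + a (k + 1) * F (k + 1))).order := by
    intro N
    induction N with
    | zero =>
      intro k
      have e : cfDenom a b 0 k - (b k + a (k + 1) * F (k + 1)) = a (k + 1) * -F (k + 1) := by
        simp only [cfDenom]; ring
      rw [e]
      apply hmul
      simpa using MvPowerSeries.one_le_order_iff_constCoeff_eq_zero.2 (ha k)
    | succ N ih =>
      intro k
      set D := cfDenom a b N (k + 1) with hD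
      have e : cfDenom a b (N + 1) k - (b k + a (k + 1) * F (k + 1))
          = a (k + 1) * (D - (b (k + 1) + a (k + 2) * F (k + 2))) * -(D⁻¹ * F (k + 1)) := by
        have h1 : D * D⁻¹ = 1 := hinv N (k + 1)
        have h2 := hF (k + 1)
        simp only [cfDenom, ← hD]
        linear_combination (a (k + 1) * F (k + 1)) * h1 - a (k + 1) * D⁻¹ * h2
      rw [e]
      apply hmul
      refine le_trans ?_ MvPowerSeries.le_order_mul
      rw [Nat.cast_add, add_comm]
      exact add_le_add (by simpa using MvPowerSeries.one_le_order_iff_constCoeff_eq_zero.2 (ha k))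
        (ih (k + 1))
  refine ⟨fun N k => MvPowerSeries.isUnit_iff_constantCoeff.2 (by rw [hc]; exact isUnit_one),
    fun d => ?_⟩
  filter_upwards [eventually_ge_atTop d.degree] with N hN
  have e : convergent a b N - F 0
      = (cfDenom a b N 0 - (b 0 + a 1 * F 1)) * -((cfDenom a b N 0)⁻¹ * F 0) := by
    rw [convergent, ha0]
    linear_combination F 0 * hinv N 0 - (cfDenom a b N 0)⁻¹ * hF 0
  rw [← sub_eq_zero, ← map_sub, e]
  refine MvPowerSeries.coeff_of_lt_order (lt_of_lt_of_le ?_ (hmul _ _ (hord N 0)))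
  exact_mod_cast Nat.lt_succ_of_le hN

end ContinuedFractions

/-! ### Direct sums and wrapping of permutations -/

/-- The direct sum `π ⊕ ρ`: the word `π` followed by the word `ρ` with its values shifted above
those of `π`. -/
def dirSum {m l : ℕ} (π : Equiv.Perm (Fin m)) (ρ : Equiv.Perm (Fin l)) :
    Equiv.Perm (Fin (m + l)) :=
  finSumFinEquiv.permCongr (π.sumCongr ρ)

@[simp] theorem dirSum_castAdd {m l : ℕ} (π : Equiv.Perm (Fin m)) (ρ : Equiv.Perm (Fin l))
    (i : Fin m) : dirSum π ρ (Fin.castAdd l i) = Fin.castAdd l (π i) := by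
  simp [dirSum, Equiv.permCongr_apply]

@[simp] theorem dirSum_natAdd {m l : ℕ} (π : Equiv.Perm (Fin m)) (ρ : Equiv.Perm (Fin l))
    (i : Fin l) : dirSum π ρ (Fin.natAdd m i) = Fin.natAdd m (ρ i) := by
  simp [dirSum, Equiv.permCongr_apply]

theorem sign_dirSum {m l : ℕ} (π : Equiv.Perm (Fin m)) (ρ : Equiv.Perm (Fin l)) :
    Equiv.Perm.sign (dirSum π ρ) = Equiv.Perm.sign π * Equiv.Perm.sign ρ := by
  rw [dirSum, Equiv.Perm.sign_permCongr, Equiv.Perm.sign_sumCongr]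

theorem dirSum_injective {m l : ℕ} {π π' : Equiv.Perm (Fin m)} {ρ ρ' : Equiv.Perm (Fin l)}
    (h : dirSum π ρ = dirSum π' ρ') : π = π' ∧ ρ = ρ' := by
  constructor
  · ext i
    simpa [Fin.ext_iff] using congrArg (fun τ => τ (Fin.castAdd l i)) h
  · ext i
    simpa [Fin.ext_iff] using congrArg (fun τ => τ (Fin.natAdd m i)) h

/-- The two extreme positions and the `m` inner positions of `Fin (m + 2)`. -/
noncomputable def endsInnerEquiv (m : ℕ) : Fin 2 ⊕ Fin m ≃ Fin (m + 2) :=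
  Equiv.ofBijective (Sum.elim ![0, Fin.last (m + 1)] fun i => i.castSucc.succ) <| by
    refine (Fintype.bijective_iff_injective_and_card _).2 ⟨?_, by simp [add_comm]⟩
    rintro (i | i) (j | j) h
    · fin_cases i <;> fin_cases j <;> simp_all [Fin.ext_iff]
    · fin_cases i <;> simp_all [Fin.ext_iff]; omega
    · fin_cases j <;> simp_all [Fin.ext_iff]; omega
    · simp_all [Fin.ext_iff]

@[simp] theorem endsInnerEquiv_inl_zero (m : ℕ) : endsInnerEquiv m (Sum.inl 0) = 0 := rfl

@[simp] theorem endsInnerEquiv_inl_one (m : ℕ) :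
    endsInnerEquiv m (Sum.inl 1) = Fin.last (m + 1) := rfl

@[simp] theorem endsInnerEquiv_inr (m : ℕ) (i : Fin m) :
    endsInnerEquiv m (Sum.inr i) = i.castSucc.succ := rfl

/-- The permutation obtained from the word `π` of length `m` by shifting its values up by one,
putting the new largest value in front and the new smallest value at the end. -/
noncomputable def wrap {m : ℕ} (π : Equiv.Perm (Fin m)) : Equiv.Perm (Fin (m + 2)) :=
  (endsInnerEquiv m).permCongr ((Equiv.swap 0 1).sumCongr π)

@[simp] theorem wrap_zero {m : ℕ} (π : Equiv.Perm (Fin m)) : wrap π 0 = Fin.last (m + 1) := by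
  have h := (endsInnerEquiv m).symm_apply_apply (Sum.inl 0)
  rw [endsInnerEquiv_inl_zero] at h
  simp [wrap, Equiv.permCongr_apply, h]

@[simp] theorem wrap_last {m : ℕ} (π : Equiv.Perm (Fin m)) : wrap π (Fin.last (m + 1)) = 0 := by
  have h := (endsInnerEquiv m).symm_apply_apply (Sum.inl 1)
  rw [endsInnerEquiv_inl_one] at h
  simp [wrap, Equiv.permCongr_apply, h]

@[simp] theorem wrap_inner {m : ℕ} (π : Equiv.Perm (Fin m)) (i : Fin m) :
    wrap π i.castSucc.succ = (π i).castSucc.succ := by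
  have h := (endsInnerEquiv m).symm_apply_apply (Sum.inr i)
  rw [endsInnerEquiv_inr] at h
  simp [wrap, Equiv.permCongr_apply, h]

theorem sign_wrap {m : ℕ} (π : Equiv.Perm (Fin m)) :
    Equiv.Perm.sign (wrap π) = -Equiv.Perm.sign π := by
  rw [wrap, Equiv.Perm.sign_permCongr, Equiv.Perm.sign_sumCongr,
    Equiv.Perm.sign_swap (by decide), neg_one_mul]

theorem wrap_injective {m : ℕ} : Function.Injective (wrap (m := m)) := by
  intro π π' h
  ext i
  simpa [Fin.ext_iff] using congrArg (fun τ => τ i.castSucc.succ) h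

theorem endsInner_cases {m : ℕ} {P : Fin (m + 2) → Prop} (h0 : P 0) (hl : P (Fin.last (m + 1)))
    (hi : ∀ i : Fin m, P i.castSucc.succ) (i : Fin (m + 2)) : P i := by
  obtain ⟨j, rfl⟩ := (endsInnerEquiv m).surjective i
  rcases j with j | j
  · fin_cases j
    exacts [h0, hl]
  · exact hi j

/-- A permutation that exchanges the two extreme positions is wrapped. -/
theorem exists_eq_wrap {m : ℕ} (π : Equiv.Perm (Fin (m + 2))) (h0 : π 0 = Fin.last (m + 1))
    (hl : π (Fin.last (m + 1)) = 0) : ∃ ρ, π = wrap ρ := by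
  have hmem := Equiv.Perm.mem_sumCongrHom_range_of_perm_mapsTo_inl
    (σ := (endsInnerEquiv m).symm.permCongr π) <| by
      rintro _ ⟨i, rfl⟩
      fin_cases i
      · exact ⟨1, by simp [Equiv.permCongr_apply, h0, Equiv.eq_symm_apply]⟩
      · exact ⟨0, by simp [Equiv.permCongr_apply, hl, Equiv.eq_symm_apply]⟩
  obtain ⟨⟨τ, ρ⟩, h⟩ := hmem
  refine ⟨ρ, Equiv.ext (endsInner_cases ?_ ?_ fun i => ?_)⟩
  · rw [h0, wrap_zero]
  · rw [hl, wrap_last]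
  · have := congrArg (fun σ => endsInnerEquiv m (σ (Sum.inr i))) h
    simpa [Equiv.permCongr_apply] using this.symm

/-- A permutation that preserves the first `m` positions is a direct sum. -/
theorem exists_eq_dirSum {m l : ℕ} (π : Equiv.Perm (Fin (m + l)))
    (h : ∀ i : Fin m, (π (Fin.castAdd l i) : ℕ) < m) : ∃ σ ρ, π = dirSum σ ρ := by
  have hmem := Equiv.Perm.mem_sumCongrHom_range_of_perm_mapsTo_inl
    (σ := (finSumFinEquiv (m := m) (n := l)).symm.permCongr π) <| by
      rintro _ ⟨i, rfl⟩
      refine ⟨⟨_, h i⟩, ?_⟩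
      simp [Equiv.permCongr_apply, Equiv.eq_symm_apply]
  obtain ⟨⟨σ, ρ⟩, h⟩ := hmem
  refine ⟨σ, ρ, ?_⟩
  have h' : σ.sumCongr ρ = finSumFinEquiv.symm.permCongr π := h
  rw [dirSum, h']
  ext
  simp [Equiv.permCongr_apply]

/-! ### Avoidance of `3412` -/

theorem avoids_pattern3412_iff {n : ℕ} (π : Equiv.Perm (Fin n)) :
    Avoids π pattern3412 ↔
      ∀ a b c d, a < b → b < c → c < d → π c < π d → π d < π a → ¬ π a < π b := by
  rw [Avoids, occurrences, Finset.filter_eq_empty_iff]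
  constructor
  · intro h a b c d hab hbc hcd h1 h2 h3
    refine h (Finset.mem_univ ![a, b, c, d]) ⟨?_, ?_⟩
    · intro i j hij
      fin_cases i <;> fin_cases j <;> simp at hij ⊢ <;> order
    · intro i j
      fin_cases i <;> fin_cases j <;> simp [pattern3412] <;> order
  · rintro h f - ⟨hf, hp⟩
    exact h (f 0) (f 1) (f 2) (f 3) (hf _ _ (by decide)) (hf _ _ (by decide)) (hf _ _ (by decide))
      ((hp _ _).2 (by decide)) ((hp _ _).2 (by decide)) ((hp _ _).2 (by decide))

theorem avoids_dirSum_iff {m l : ℕ} (π : Equiv.Perm (Fin m)) (ρ : Equiv.Perm (Fin l)) :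
    Avoids (dirSum π ρ) pattern3412 ↔ Avoids π pattern3412 ∧ Avoids ρ pattern3412 := by
  simp only [avoids_pattern3412_iff]
  constructor
  · intro h
    constructor
    · intro a b c d
      simpa only [dirSum_castAdd, Fin.lt_def, Fin.val_castAdd] using
        h (Fin.castAdd l a) (Fin.castAdd l b) (Fin.castAdd l c) (Fin.castAdd l d)
    · intro a b c d
      simpa only [dirSum_natAdd, Fin.lt_def, Fin.val_natAdd, add_lt_add_iff_left] using
        h (Fin.natAdd m a) (Fin.natAdd m b) (Fin.natAdd m c) (Fin.natAdd m d)
  · rintro ⟨hπ, hρ⟩ a b c d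
    refine Fin.addCases (fun a => ?_) (fun a => ?_) a <;>
    refine Fin.addCases (fun b => ?_) (fun b => ?_) b <;>
    refine Fin.addCases (fun c => ?_) (fun c => ?_) c <;>
    refine Fin.addCases (fun d => ?_) (fun d => ?_) d <;>
    simp only [dirSum_castAdd, dirSum_natAdd, Fin.lt_def, Fin.val_castAdd, Fin.val_natAdd] <;>
    first
    | exact hπ a b c d
    | simpa only [Fin.lt_def, add_lt_add_iff_left] using hρ a b c d
    | (have := b.2
       have := c.2
       have := d.2
       omega)

theorem avoids_wrap_iff {m : ℕ} (π : Equiv.Perm (Fin m)) :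
    Avoids (wrap π) pattern3412 ↔ Avoids π pattern3412 := by
  simp only [avoids_pattern3412_iff]
  constructor
  · intro h a b c d
    simpa only [wrap_inner, Fin.succ_lt_succ_iff, Fin.castSucc_lt_castSucc_iff] using
      h a.castSucc.succ b.castSucc.succ c.castSucc.succ d.castSucc.succ
  · intro hπ a b c d hab hbc hcd h1 h2 h3
    have ha : a ≠ 0 := by
      rintro rfl
      rw [wrap_zero] at h3
      exact absurd h3 (Fin.le_last _).not_gt
    have hd : d ≠ Fin.last (m + 1) := by
      rintro rfl
      rw [wrap_last] at h1
      exact absurd h1 (Fin.zero_le _).not_gt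
    have key : ∀ i : Fin (m + 2), a ≤ i → i ≤ d → ∃ j : Fin m, i = j.castSucc.succ := by
      intro i hi hi'
      refine endsInner_cases (P := fun i => a ≤ i → i ≤ d → ∃ j : Fin m, i = j.castSucc.succ)
        (fun h => absurd (le_antisymm h (Fin.zero_le _)) ha)
        (fun _ h => absurd (le_antisymm (Fin.le_last _) h) hd) (fun j _ _ => ⟨j, rfl⟩) i hi hi'
    obtain ⟨a', rfl⟩ := key a le_rfl (hab.trans (hbc.trans hcd)).le
    obtain ⟨b', rfl⟩ := key b hab.le (hbc.trans hcd).le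
    obtain ⟨c', rfl⟩ := key c (hab.trans hbc).le hcd.le
    obtain ⟨d', rfl⟩ := key d (hab.trans (hbc.trans hcd)).le le_rfl
    simp only [wrap_inner, Fin.castSucc_lt_castSucc_iff, Fin.succ_lt_succ_iff]
      at hab hbc hcd h1 h2 h3
    exact hπ a' b' c' d' hab hbc hcd h1 h2 h3

/-! ### The decomposition of `3412`-avoiding involutions -/

theorem mem_I3412_dirSum {m l : ℕ} (π : Equiv.Perm (Fin m)) (ρ : Equiv.Perm (Fin l)) :
    (⟨m + l, dirSum π ρ⟩ : AnyPerm) ∈ I3412 ↔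
      (⟨m, π⟩ : AnyPerm) ∈ I3412 ∧ (⟨l, ρ⟩ : AnyPerm) ∈ I3412 := by
  simp only [I3412, Set.mem_ofPred_eq, avoids_dirSum_iff, Fin.forall_fin_add, dirSum_castAdd,
    dirSum_natAdd, Fin.castAdd_inj, Fin.natAdd_inj]
  tauto

theorem mem_I3412_wrap {m : ℕ} (π : Equiv.Perm (Fin m)) :
    (⟨m + 2, wrap π⟩ : AnyPerm) ∈ I3412 ↔ (⟨m, π⟩ : AnyPerm) ∈ I3412 := by
  simp only [I3412, Set.mem_ofPred_eq, avoids_wrap_iff]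
  refine and_congr_left fun _ => ⟨fun h i => ?_, fun h => endsInner_cases ?_ ?_ ?_⟩
  · simpa [Fin.ext_iff] using h i.castSucc.succ
  · simp
  · simp
  · simp [h]

theorem mem_I3412_of_subsingleton {n : ℕ} (h : n ≤ 1) (π : Equiv.Perm (Fin n)) :
    (⟨n, π⟩ : AnyPerm) ∈ I3412 := by
  have : Subsingleton (Fin n) := Fin.subsingleton_iff_le_one.2 h
  refine ⟨fun i => Subsingleton.elim _ _, (avoids_pattern3412_iff _).2 ?_⟩
  intro a b c d hab
  exact absurd (Subsingleton.elim a b) hab.ne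

/-- The empty permutation. -/
def emptyInv : I3412 := ⟨⟨0, 1⟩, mem_I3412_of_subsingleton zero_le_one _⟩

/-- The involution `1 ⊕ ρ`. -/
def fixInv (ρ : I3412) : I3412 :=
  ⟨⟨1 + ρ.1.1, dirSum (1 : Equiv.Perm (Fin 1)) ρ.1.2⟩,
    (mem_I3412_dirSum _ _).2 ⟨mem_I3412_of_subsingleton le_rfl _, ρ.2⟩⟩

/-- The involution `wrap π ⊕ ρ`. -/
noncomputable def wrapInv (p : I3412 × I3412) : I3412 :=
  ⟨⟨p.1.1.1 + 2 + p.2.1.1, dirSum (wrap p.1.1.2) p.2.1.2⟩,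
    (mem_I3412_dirSum _ _).2 ⟨(mem_I3412_wrap _).2 p.1.2, p.2.2⟩⟩

/-- An involution that avoids `3412` is empty, or starts with a fixed point, or has an initial
block that exchanges its two extreme positions. -/
noncomputable def assemble : Option (I3412 ⊕ I3412 × I3412) → I3412
  | none => emptyInv
  | some (Sum.inl ρ) => fixInv ρ
  | some (Sum.inr p) => wrapInv p

/-- The first value of a permutation, or `0` for the empty permutation. -/
def firstValue (π : AnyPerm) : ℕ := if h : 0 < π.1 then (π.2 ⟨0, h⟩ : ℕ) else 0

theorem firstValue_fixInv (ρ : I3412) : firstValue (fixInv ρ).1 = 0 := by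
  have h : dirSum (1 : Equiv.Perm (Fin 1)) ρ.1.2 (Fin.castAdd _ 0) = Fin.castAdd _ 0 := by simp
  have hp : 0 < 1 + ρ.1.1 := by omega
  exact (dif_pos hp).trans (congrArg Fin.val h)

theorem firstValue_wrapInv (p : I3412 × I3412) :
    firstValue (wrapInv p).1 = p.1.1.1 + 1 := by
  have h : dirSum (wrap p.1.1.2) p.2.1.2 (Fin.castAdd _ 0) = Fin.castAdd _ (Fin.last _) := by simp
  have hp : 0 < p.1.1.1 + 2 + p.2.1.1 := by omega
  exact (dif_pos hp).trans (congrArg Fin.val h)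

/-- The length and the first value determine the case and the sizes of the blocks. -/
theorem assemble_injective : Function.Injective assemble := by
  have hlen : ∀ {x y : I3412}, x = y → x.1.1 = y.1.1 := fun h => by rw [h]
  have hfirst : ∀ {x y : I3412}, x = y → firstValue x.1 = firstValue y.1 := fun h => by rw [h]
  rintro (_ | ρ | p) (_ | ρ' | p') h <;> simp only [assemble] at h
  · rfl
  · have := hlen h; simp only [emptyInv, fixInv] at this; omega
  · have := hlen h; simp only [emptyInv, wrapInv] at this; omega
  · have := hlen h; simp only [emptyInv, fixInv] at this; omega
  · obtain ⟨⟨l, ρ⟩, hρ⟩ := ρ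
    obtain ⟨⟨l', ρ'⟩, hρ'⟩ := ρ'
    have h1 := hlen h
    simp only [fixInv] at h1
    obtain rfl : l = l' := by omega
    have h2 := eq_of_heq (Sigma.mk.inj (congrArg Subtype.val h)).2
    obtain rfl := (dirSum_injective h2).2
    rfl
  · have := hfirst h; rw [firstValue_fixInv, firstValue_wrapInv] at this; omega
  · have := hlen h; simp only [emptyInv, wrapInv] at this; omega
  · have := hfirst h; rw [firstValue_fixInv, firstValue_wrapInv] at this; omega
  · obtain ⟨⟨⟨m, π⟩, hπ⟩, ⟨⟨l, ρ⟩, hρ⟩⟩ := p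
    obtain ⟨⟨⟨m', π'⟩, hπ'⟩, ⟨⟨l', ρ'⟩, hρ'⟩⟩ := p'
    have h0 := hfirst h
    rw [firstValue_wrapInv, firstValue_wrapInv] at h0
    simp only at h0
    obtain rfl : m = m' := by omega
    have h1 := hlen h
    simp only [wrapInv] at h1
    obtain rfl : l = l' := by omega
    have h2 := eq_of_heq (Sigma.mk.inj (congrArg Subtype.val h)).2
    obtain ⟨h3, rfl⟩ := dirSum_injective h2
    obtain rfl := wrap_injective h3
    rfl

/-- If `π` exchanges positions `0` and `k`, an inner position `i` of this interval with `π i > k`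
would give an occurrence of `3412` at the positions `0 < i < k < π i`. -/
theorem val_le_of_le_first {n : ℕ} {π : Equiv.Perm (Fin (n + 1))}
    (hπ : (⟨n + 1, π⟩ : AnyPerm) ∈ I3412) {i : Fin (n + 1)} (hi : i ≤ π 0) : π i ≤ π 0 := by
  by_contra! hlt
  have hinv : ∀ j, π (π j) = j := hπ.1
  have h0 : i ≠ 0 := by rintro rfl; exact lt_irrefl _ hlt
  have hk : i ≠ π 0 := by
    rintro rfl
    rw [hinv] at hlt
    exact absurd hlt (Fin.zero_le _).not_gt
  have hpos : 0 < i := Fin.pos_iff_ne_zero.2 h0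
  have hik : i < π 0 := lt_of_le_of_ne hi hk
  refine (avoids_pattern3412_iff π).1 hπ.2 0 i (π 0) (π i) hpos hik hlt ?_ ?_ hlt
  · rwa [hinv, hinv]
  · rwa [hinv]

theorem assemble_surjective : Function.Surjective assemble := by
  rintro ⟨⟨n, π⟩, hπ⟩
  rcases n with _ | n
  · exact ⟨none, Subtype.ext (Sigma.ext rfl (heq_of_eq
      (Equiv.ext fun i : Fin 0 => i.elim0)))⟩
  obtain ⟨k, hk⟩ : ∃ k : ℕ, k = (π 0 : ℕ) := ⟨_, rfl⟩
  obtain ⟨l, hl⟩ : ∃ l, n + 1 = k + 1 + l := ⟨n - k, by have := (π 0).2; omega⟩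
  have hblock : ∀ i : Fin (n + 1), (i : ℕ) < k + 1 → (π i : ℕ) < k + 1 := by
    intro i hi
    have := Fin.le_def.1 (val_le_of_le_first hπ (i := i) (Fin.le_def.2 (by omega)))
    omega
  have hfirst : firstValue ⟨n + 1, π⟩ = k := by simp [firstValue, hk]
  -- `hk` ties the type of `π` to a successor, and `firstValue` allows the length to be rewritten
  -- as `k + 1 + l`.
  clear hk
  generalize n + 1 = N at *
  subst hl
  obtain ⟨σ, ρ, rfl⟩ := exists_eq_dirSum π fun i => hblock _ (Fin.is_lt i)
  obtain ⟨hσ, hρ⟩ := (mem_I3412_dirSum σ ρ).1 hπ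
  have h0 : (σ 0 : ℕ) = k := by
    have hp : 0 < k + 1 + l := by omega
    have e : dirSum σ ρ (Fin.castAdd l 0) = Fin.castAdd l (σ 0) := dirSum_castAdd _ _ _
    simp only [firstValue, hp, dite_true] at hfirst
    exact (congrArg Fin.val e).symm.trans hfirst
  rcases k with _ | m
  · refine ⟨some (Sum.inl ⟨⟨l, ρ⟩, hρ⟩), ?_⟩
    obtain rfl : σ = 1 := Equiv.ext fun i => Fin.ext (by have := (σ i).2; have := i.2; simp)
    rfl
  · have h0' : σ 0 = Fin.last (m + 1) := Fin.ext h0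
    obtain ⟨α, rfl⟩ := exists_eq_wrap σ h0' (by rw [← h0']; exact hσ.1 0)
    exact ⟨some (Sum.inr (⟨⟨m, α⟩, (mem_I3412_wrap α).1 hσ⟩, ⟨⟨l, ρ⟩, hρ⟩)), rfl⟩

/-- The decomposition of `3412`-avoiding involutions as a bijection. -/
noncomputable def assembleEquiv : Option (I3412 ⊕ I3412 × I3412) ≃ I3412 :=
  Equiv.ofBijective assemble ⟨assemble_injective, assemble_surjective⟩

/-! ### Cliques of a relation -/

/-- The `k`-element sets of pairwise related elements. -/
def cliques {V : Type*} (r : V → V → Prop) (k : ℕ) : Set (Finset V) :=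
  {s | s.card = k ∧ (s : Set V).Pairwise r}

section Cliques

variable {U V W : Type*}

theorem ncard_cliques_zero (r : V → V → Prop) : (cliques r 0).ncard = 1 := by
  rw [Set.ncard_eq_one]
  refine ⟨∅, Set.ext fun s => ?_⟩
  simp only [cliques, Set.mem_ofPred_eq, Finset.card_eq_zero, Set.mem_singleton_iff]
  exact ⟨fun h => h.1, fun h => ⟨h, by simp [h]⟩⟩

theorem map_mem_cliques_iff {r : W → W → Prop} {f : V ↪ W} {k : ℕ} {s : Finset V} :
    s.map f ∈ cliques r k ↔ s ∈ cliques (fun i j => r (f i) (f j)) k := by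
  simp only [cliques, Set.mem_ofPred_eq, Finset.card_map, Finset.coe_map]
  rw [f.injective.injOn.pairwise_image]

theorem exists_eq_map {f : V ↪ W} {s : Finset W} (hs : ∀ w ∈ s, w ∈ Set.range f) :
    ∃ u : Finset V, s = u.map f := by
  classical
  refine ⟨s.preimage f f.injective.injOn, ?_⟩
  rw [Finset.map_eq_image, Finset.image_preimage, Finset.filter_true_of_mem hs]

/-- If no element of `U` is related to an element of `V`, a nonempty clique of the union lies in
one of the two parts. -/
theorem ncard_cliques_union [Finite W] {r : W → W → Prop} (f : U ↪ W) (g : V ↪ W)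
    (hfg : ∀ w, w ∈ Set.range f ∨ w ∈ Set.range g) (hr : ∀ u v, ¬ r (f u) (g v))
    (hne : ∀ u v, f u ≠ g v) (k : ℕ) :
    (cliques r (k + 1)).ncard = (cliques (fun i j => r (f i) (f j)) (k + 1)).ncard +
      (cliques (fun i j => r (g i) (g j)) (k + 1)).ncard := by
  have e : cliques r (k + 1) = Finset.map f '' cliques (fun i j => r (f i) (f j)) (k + 1) ∪
      Finset.map g '' cliques (fun i j => r (g i) (g j)) (k + 1) := by
    ext s
    constructor
    · intro hs
      obtain ⟨w, hw⟩ : s.Nonempty := Finset.card_pos.1 (by rw [hs.1]; exact k.succ_pos)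
      rcases hfg w with ⟨u, rfl⟩ | ⟨v, rfl⟩
      · obtain ⟨t, rfl⟩ : ∃ t : Finset U, s = t.map f := exists_eq_map fun w' hw' => by
          refine (hfg w').resolve_right ?_
          rintro ⟨v, rfl⟩
          exact hr u v (hs.2 hw hw' (hne u v))
        exact Or.inl ⟨t, map_mem_cliques_iff.1 hs, rfl⟩
      · obtain ⟨t, rfl⟩ : ∃ t : Finset V, s = t.map g := exists_eq_map fun w' hw' => by
          refine (hfg w').resolve_left ?_
          rintro ⟨u, rfl⟩
          exact hr u v (hs.2 hw' hw (hne u v))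
        exact Or.inr ⟨t, map_mem_cliques_iff.1 hs, rfl⟩
    · rintro (⟨t, ht, rfl⟩ | ⟨t, ht, rfl⟩) <;> exact map_mem_cliques_iff.2 ht
  rw [e, Set.ncard_union_eq, Set.ncard_image_of_injective _ (Finset.map_injective f),
    Set.ncard_image_of_injective _ (Finset.map_injective g)]
  rw [Set.disjoint_left]
  rintro _ ⟨s, hs, rfl⟩ ⟨t, -, h⟩
  obtain ⟨u, hu⟩ : s.Nonempty := Finset.card_pos.1 (by rw [hs.1]; exact k.succ_pos)
  obtain ⟨v, -, hv⟩ := Finset.mem_map.1 (h ▸ Finset.mem_map_of_mem f hu)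
  exact hne u v hv.symm

/-- A clique of a cone either avoids the apex `w`, or consists of the apex and a clique of the
base. -/
theorem ncard_cliques_cone [Finite W] {r : W → W → Prop} (hsymm : Std.Symm r) (f : V ↪ W)
    (w : W) (hrange : ∀ w', w' = w ∨ w' ∈ Set.range f) (hw : ∀ v, f v ≠ w)
    (hr : ∀ v, r w (f v)) (k : ℕ) :
    (cliques r (k + 1)).ncard = (cliques (fun i j => r (f i) (f j)) (k + 1)).ncard +
      (cliques (fun i j => r (f i) (f j)) k).ncard := by
  classical
  have hnot : ∀ t : Finset V, w ∉ t.map f := fun t h => by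
    obtain ⟨v, -, hv⟩ := Finset.mem_map.1 h
    exact hw v hv
  have e : cliques r (k + 1) = Finset.map f '' cliques (fun i j => r (f i) (f j)) (k + 1) ∪
      (fun t => insert w (t.map f)) '' cliques (fun i j => r (f i) (f j)) k := by
    ext s
    constructor
    · intro hs
      by_cases hws : w ∈ s
      · obtain ⟨t, ht⟩ : ∃ t : Finset V, s.erase w = t.map f := exists_eq_map fun w' hw' =>
          (hrange w').resolve_left (Finset.ne_of_mem_erase hw')
        refine Or.inr ⟨t, map_mem_cliques_iff.1 ?_, ?_⟩
        · rw [← ht]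
          exact ⟨by rw [Finset.card_erase_of_mem hws, hs.1, Nat.add_sub_cancel],
            hs.2.mono (by simp)⟩
        · simp only [← ht, Finset.insert_erase hws]
      · obtain ⟨t, rfl⟩ : ∃ t : Finset V, s = t.map f := exists_eq_map fun w' hw' =>
          (hrange w').resolve_left (ne_of_mem_of_not_mem hw' hws)
        exact Or.inl ⟨t, map_mem_cliques_iff.1 hs, rfl⟩
    · rintro (⟨t, ht, rfl⟩ | ⟨t, ht, rfl⟩)
      · exact map_mem_cliques_iff.2 ht
      · have ht' := map_mem_cliques_iff.2 ht
        refine ⟨by rw [Finset.card_insert_of_notMem (hnot t), ht'.1], ?_⟩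
        rw [Finset.coe_insert, Set.pairwise_insert_of_symm]
        refine ⟨ht'.2, fun b hb _ => ?_⟩
        obtain ⟨v, -, rfl⟩ := Finset.mem_map.1 (Finset.mem_coe.1 hb)
        exact hr v
  have hinj : Function.Injective fun t : Finset V => insert w (t.map f) := fun s t h => by
    refine Finset.map_injective f ?_
    rw [← Finset.erase_insert (hnot s), ← Finset.erase_insert (hnot t)]
    exact congrArg (fun u => u.erase w) h
  rw [e, Set.ncard_union_eq, Set.ncard_image_of_injective _ (Finset.map_injective f),
    Set.ncard_image_of_injective _ hinj]
  rw [Set.disjoint_left]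
  rintro _ ⟨s, -, rfl⟩ ⟨t, -, h⟩
  exact hnot s (h ▸ Finset.mem_insert_self w _)

end Cliques

/-! ### Decreasing subsequences of direct sums and wrapped permutations -/

/-- Two positions are related when they are equal or form an inversion. -/
def invRel {n : ℕ} (π : Equiv.Perm (Fin n)) (i j : Fin n) : Prop := i < j ↔ π j < π i

theorem symm_invRel {n : ℕ} (π : Equiv.Perm (Fin n)) : Std.Symm (invRel π) := by
  refine ⟨fun i j h => ?_⟩
  rcases eq_or_ne i j with rfl | hne
  · exact h
  · have hne' : π i ≠ π j := π.injective.ne hne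
    unfold invRel at *
    constructor
    · intro hji
      by_contra hlt
      exact absurd (h.2 (lt_of_le_of_ne (not_lt.1 hlt) hne'.symm)) hji.not_gt
    · intro hlt
      by_contra hji
      exact absurd (h.1 (lt_of_le_of_ne (not_lt.1 hji) hne)) hlt.not_gt

/-- Decreasing subsequences of length `k` correspond to `k`-cliques of the inversion graph. -/
theorem tau_eq_ncard_cliques {n : ℕ} (π : Equiv.Perm (Fin n)) (k : ℕ) :
    tau k π = (cliques (invRel π) k).ncard := by
  classical
  have hmem : ∀ f : Fin k → Fin n, f ∈ occurrences π (Fin.revPerm : Equiv.Perm (Fin k)) ↔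
      StrictMono f ∧ ∀ i j, π (f i) < π (f j) ↔ j < i := by
    intro f
    simp only [occurrences, Finset.mem_filter_univ, Fin.revPerm_apply, Fin.rev_lt_rev]
    exact and_congr_left fun _ => ⟨fun h i j => h i j, fun h i j hij => h hij⟩
  have e : cliques (invRel π) k = (fun f : Fin k → Fin n => Finset.univ.image f) ''
      (occurrences π (Fin.revPerm : Equiv.Perm (Fin k)) : Set (Fin k → Fin n)) := by
    ext s
    constructor
    · rintro ⟨hs, hp⟩
      refine ⟨s.orderEmbOfFin hs, (hmem _).2 ⟨(s.orderEmbOfFin hs).strictMono, fun i j => ?_⟩, ?_⟩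
      · rcases eq_or_ne i j with rfl | hij
        · simp
        · have h : _ ↔ _ := hp (s.orderEmbOfFin_mem hs j) (s.orderEmbOfFin_mem hs i)
            ((s.orderEmbOfFin hs).injective.ne hij.symm)
          rw [← h, (s.orderEmbOfFin hs).lt_iff_lt]
      · rw [← Finset.coe_inj, Finset.coe_image, Finset.coe_univ, Set.image_univ,
          Finset.range_orderEmbOfFin]
    · rintro ⟨f, hf, rfl⟩
      obtain ⟨hf, hp⟩ := (hmem f).1 (Finset.mem_coe.1 hf)
      refine ⟨by rw [Finset.card_image_of_injective _ hf.injective, Finset.card_fin], ?_⟩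
      rw [Finset.coe_image, Finset.coe_univ, Set.image_univ]
      rintro _ ⟨i, rfl⟩ _ ⟨j, rfl⟩ -
      rw [invRel, hp, hf.lt_iff_lt]
  rw [e, Set.InjOn.ncard_image, Set.ncard_coe_finset, tau]
  intro f hf g hg h
  have hf' := ((hmem f).1 (Finset.mem_coe.1 hf)).1
  have hg' := ((hmem g).1 (Finset.mem_coe.1 hg)).1
  refine (hf'.range_inj hg').1 ?_
  simpa using congrArg (fun s : Finset (Fin n) => (s : Set (Fin n))) h

theorem tau_zero {n : ℕ} (π : Equiv.Perm (Fin n)) : tau 0 π = 1 := by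
  rw [tau_eq_ncard_cliques, ncard_cliques_zero]

theorem tau_one {n : ℕ} (π : Equiv.Perm (Fin n)) : tau 1 π = n := by
  have : occurrences π (Fin.revPerm : Equiv.Perm (Fin 1)) = Finset.univ := by
    rw [occurrences, Finset.filter_true_of_mem]
    intro f _
    constructor
    · intro i j hij
      exact absurd (Subsingleton.elim i j) hij.ne
    · intro i j
      rw [Subsingleton.elim i j]
      simp
  rw [tau, this]
  simp

theorem tau_two {n : ℕ} (π : Equiv.Perm (Fin n)) : tau 2 π = numInv π := by
  rw [tau, numInv]
  refine Finset.card_equiv (finTwoArrowEquiv (Fin n)) fun f => ?_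
  simp only [occurrences, Finset.mem_filter_univ, Fin.forall_fin_two, finTwoArrowEquiv_apply,
    Fin.revPerm_apply, Fin.rev_lt_rev]
  constructor
  · rintro ⟨⟨⟨-, h⟩, -⟩, -, h', -⟩
    exact ⟨h (by decide), h'.2 (by decide)⟩
  · rintro ⟨h, h'⟩
    replace h : f 0 < f 1 := h
    replace h' : π (f 1) < π (f 0) := h'
    simp [h, h', h'.le]

theorem tau_dirSum {m l : ℕ} (π : Equiv.Perm (Fin m)) (ρ : Equiv.Perm (Fin l)) (k : ℕ) :
    tau (k + 1) (dirSum π ρ) = tau (k + 1) π + tau (k + 1) ρ := by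
  simp only [tau_eq_ncard_cliques]
  rw [ncard_cliques_union (Fin.castAddEmb l) (Fin.natAddEmb m)]
  · congr 3
    · ext i j
      simp only [invRel, Fin.castAddEmb_apply, dirSum_castAdd, Fin.lt_def, Fin.val_castAdd]
    · ext i j
      simp only [invRel, Fin.natAddEmb_apply, dirSum_natAdd, Fin.lt_def, Fin.val_natAdd,
        add_lt_add_iff_left]
  · intro i
    refine Fin.addCases (fun i => Or.inl ⟨i, rfl⟩) (fun i => Or.inr ⟨i, rfl⟩) i
  · intro i j
    have := (π i).2
    simp [invRel, Fin.lt_def]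
    omega
  · intro i j h
    have := i.2
    simp [Fin.ext_iff] at h
    omega

/-- The inversion graph of `wrap π` is a cone over a cone over the inversion graph of `π`; here `c`
counts the cliques of the intermediate cone, whose apex is the last position. -/
theorem exists_cliques_wrap {m : ℕ} (π : Equiv.Perm (Fin m)) :
    ∃ c : ℕ → ℕ, (∀ k, c (k + 1) = tau (k + 1) π + tau k π) ∧
      ∀ k, tau (k + 1) (wrap π) = c (k + 1) + c k := by
  set r : Fin (m + 1) → Fin (m + 1) → Prop := fun i j => invRel (wrap π) i.succ j.succ with hr
  refine ⟨fun k => (cliques r k).ncard, fun k => ?_, fun k => ?_⟩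
  · have h := symm_invRel (wrap π)
    simp only [tau_eq_ncard_cliques]
    rw [ncard_cliques_cone ⟨fun i j hij => h.symm _ _ hij⟩ Fin.castSuccEmb
      (Fin.last m)]
    · have : (fun i j => r (Fin.castSuccEmb i) (Fin.castSuccEmb j))
          = invRel π := by
        ext i j
        simp only [hr, invRel, Fin.coe_castSuccEmb, wrap_inner, Fin.succ_lt_succ_iff,
          Fin.castSucc_lt_castSucc_iff]
      rw [this]
    · intro i
      exact Fin.lastCases (Or.inl rfl) (fun i => Or.inr ⟨i, rfl⟩) i
    · intro i
      exact (Fin.castSucc_lt_last i).ne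
    · intro i
      simp [invRel, Fin.lt_def]
  · rw [tau_eq_ncard_cliques]
    refine ncard_cliques_cone (symm_invRel _) (Fin.succEmb (m + 1)) 0 ?_ ?_ ?_ k
    · intro i
      exact Fin.cases (Or.inl rfl) (fun i => Or.inr ⟨i, rfl⟩) i
    · intro i
      exact Fin.succ_ne_zero i
    · intro i
      refine Fin.lastCases ?_ (fun i => ?_) i
      · simp [invRel, Fin.lt_def]
      · simp [invRel, Fin.lt_def]

theorem tau_wrap_one {m : ℕ} (π : Equiv.Perm (Fin m)) : tau 1 (wrap π) = tau 1 π + 2 := by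
  rw [tau_one, tau_one]

theorem tau_wrap_add_two {m : ℕ} (π : Equiv.Perm (Fin m)) (k : ℕ) :
    tau (k + 2) (wrap π) = tau (k + 2) π + 2 * tau (k + 1) π + tau k π := by
  obtain ⟨c, hc, h⟩ := exists_cliques_wrap π
  rw [h, hc, hc]
  ring

/-! ### Extrema and fixed points of direct sums and wrapped permutations -/

theorem card_filter_dirSum {m l : ℕ} (p : Fin (m + l) → Prop) [DecidablePred p] :
    (Finset.univ.filter p).card = (Finset.univ.filter fun i => p (Fin.castAdd l i)).card +
      (Finset.univ.filter fun i => p (Fin.natAdd m i)).card := by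
  simp only [Finset.card_filter, Fin.sum_univ_add]

theorem card_filter_ends {m : ℕ} (p : Fin (m + 2) → Prop) [DecidablePred p] :
    (Finset.univ.filter p).card = (if p 0 then 1 else 0) +
      (Finset.univ.filter fun i : Fin m => p i.castSucc.succ).card +
      (if p (Fin.last (m + 1)) then 1 else 0) := by
  simp only [Finset.card_filter, Fin.sum_univ_succ (n := m + 1), Fin.sum_univ_castSucc,
    Fin.succ_last, add_assoc]

theorem lrmax_dirSum {m l : ℕ} (π : Equiv.Perm (Fin m)) (ρ : Equiv.Perm (Fin l)) :
    lrmax (dirSum π ρ) = lrmax π + lrmax ρ := by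
  rw [lrmax, card_filter_dirSum, lrmax, lrmax]
  congr 2 <;> ext i <;> simp only [Finset.mem_filter_univ, Fin.forall_fin_add, dirSum_castAdd,
    dirSum_natAdd, Fin.lt_def, Fin.val_castAdd, Fin.val_natAdd, add_lt_add_iff_left]
  · have := i.2
    exact ⟨fun h => h.1, fun h => ⟨h, fun j hj => by omega⟩⟩
  · exact ⟨fun h => h.2, fun h => ⟨fun j _ => by have := (π j).2; omega, h⟩⟩

theorem rlmin_dirSum {m l : ℕ} (π : Equiv.Perm (Fin m)) (ρ : Equiv.Perm (Fin l)) :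
    rlmin (dirSum π ρ) = rlmin π + rlmin ρ := by
  rw [rlmin, card_filter_dirSum, rlmin, rlmin]
  congr 2 <;> ext i <;> simp only [Finset.mem_filter_univ, Fin.forall_fin_add, dirSum_castAdd,
    dirSum_natAdd, Fin.lt_def, Fin.val_castAdd, Fin.val_natAdd, add_lt_add_iff_left]
  · exact ⟨fun h => h.1, fun h => ⟨h, fun j _ => by have := (π i).2; omega⟩⟩
  · exact ⟨fun h => h.2, fun h => ⟨fun j hj => by have := j.2; omega, h⟩⟩

theorem numFix_dirSum {m l : ℕ} (π : Equiv.Perm (Fin m)) (ρ : Equiv.Perm (Fin l)) :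
    numFix (dirSum π ρ) = numFix π + numFix ρ := by
  rw [numFix, card_filter_dirSum, numFix, numFix]
  simp [Fin.ext_iff]

theorem lrmax_wrap {m : ℕ} (π : Equiv.Perm (Fin m)) : lrmax (wrap π) = 1 := by
  rw [lrmax, Finset.card_eq_one]
  refine ⟨0, Finset.ext fun i => ?_⟩
  rw [Finset.mem_filter_univ, Finset.mem_singleton]
  constructor
  · intro h
    by_contra hi
    have := h 0 (Fin.pos_iff_ne_zero.2 hi)
    rw [wrap_zero] at this
    exact absurd this (Fin.le_last _).not_gt
  · rintro rfl j hj
    exact absurd hj (Fin.zero_le j).not_gt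

theorem rlmin_wrap {m : ℕ} (π : Equiv.Perm (Fin m)) : rlmin (wrap π) = 1 := by
  rw [rlmin, Finset.card_eq_one]
  refine ⟨Fin.last (m + 1), Finset.ext fun i => ?_⟩
  rw [Finset.mem_filter_univ, Finset.mem_singleton]
  constructor
  · intro h
    by_contra hi
    have := h _ (Fin.lt_last_iff_ne_last.2 hi)
    rw [wrap_last] at this
    exact absurd this (Fin.zero_le _).not_gt
  · rintro rfl j hj
    exact absurd hj (Fin.le_last j).not_gt

theorem numFix_wrap {m : ℕ} (π : Equiv.Perm (Fin m)) : numFix (wrap π) = numFix π := by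
  rw [numFix, card_filter_ends, numFix]
  simp [Fin.ext_iff]

/-! ### The functional equation of a signed generating function -/

section FunctionalEquation

variable {σ : Type*}

theorem formallySummable_of_le_order {f : I3412 → MvPowerSeries σ ℚ}
    (hf : ∀ π, (π.1.1 : ℕ∞) ≤ (f π).order) : FormallySummable f := by
  intro d
  have hfin : (⋃ n ∈ Set.Iic d.degree, Set.range fun π : Equiv.Perm (Fin n) =>
      (⟨n, π⟩ : AnyPerm)).Finite :=
    (Set.finite_Iic _).biUnion fun n _ => Set.finite_range _
  refine (hfin.preimage Subtype.val_injective.injOn).subset fun π hπ => ?_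
  refine Set.mem_biUnion (x := π.1.1) ?_ ⟨π.1.2, rfl⟩
  by_contra hlt
  refine hπ (MvPowerSeries.coeff_of_lt_order (lt_of_lt_of_le ?_ (hf π)))
  exact_mod_cast not_le.1 hlt

theorem le_order_mul_of_le_right {f g : MvPowerSeries σ ℚ} {n : ℕ} (h : (n : ℕ∞) ≤ g.order) :
    (n : ℕ∞) ≤ (f * g).order :=
  (h.trans le_add_self).trans MvPowerSeries.le_order_mul

/-- The decomposition of `3412`-avoiding involutions, translated to formal sums. -/
theorem formalSum_functional_equation {f g : I3412 → MvPowerSeries σ ℚ}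
    (hf : FormallySummable f) (hg : FormallySummable g) {a b : MvPowerSeries σ ℚ}
    (h0 : f emptyInv = 1) (h1 : ∀ ρ, f (fixInv ρ) = a * f ρ)
    (h2 : ∀ p, f (wrapInv p) = -b * (g p.1 * f p.2)) :
    formalSum f * (1 - a + b * formalSum g) = 1 := by
  have hs := hf.comp_injective assembleEquiv.injective
  have hs' := hs.comp_injective (Option.some_injective _)
  have e : formalSum f = 1 + (a * formalSum f + -b * (formalSum g * formalSum f)) := by
    conv_lhs => rw [← formalSum_comp_equiv assembleEquiv, formalSum_option hs, formalSum_sum hs']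
    rw [← formalSum_mul hg hf, ← formalSum_const_mul hf, ← formalSum_const_mul (hg.mul hf)]
    congr 1
    congr 2
    · exact funext h1
    · exact funext h2
  linear_combination e

theorem signSeries_one {n : ℕ} : (signSeries (1 : Equiv.Perm (Fin n)) : MvPowerSeries σ ℚ) = 1 := by
  simp [signSeries]

theorem signSeries_dirSum {m l : ℕ} (π : Equiv.Perm (Fin m)) (ρ : Equiv.Perm (Fin l)) :
    (signSeries (dirSum π ρ) : MvPowerSeries σ ℚ) = signSeries π * signSeries ρ := by
  simp [signSeries, sign_dirSum]

theorem signSeries_wrap {m : ℕ} (π : Equiv.Perm (Fin m)) :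
    (signSeries (wrap π) : MvPowerSeries σ ℚ) = -signSeries π := by
  simp [signSeries, sign_wrap]

end FunctionalEquation

/-! ### Decreasing subsequences with arbitrary weights -/

section TauWeights

variable {σ : Type*}

/-- The term `sign(π) ∏_{k ≥ 1} y_k ^ τ_k(π)` for arbitrary series `y_k`. -/
noncomputable def tauWeight (y : ℕ → MvPowerSeries σ ℚ) (π : I3412) : MvPowerSeries σ ℚ :=
  signSeries π.1.2 * ∏ k ∈ Finset.range π.1.1, y (k + 1) ^ tau (k + 1) π.1.2

theorem prod_tau_eq {R : Type*} [CommMonoid R] (y : ℕ → R) {n N : ℕ} (π : Equiv.Perm (Fin n))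
    (h : n ≤ N) : ∏ k ∈ Finset.range n, y (k + 1) ^ tau (k + 1) π =
      ∏ k ∈ Finset.range N, y (k + 1) ^ tau (k + 1) π := by
  refine Finset.prod_subset (Finset.range_mono h) fun k _ hk => ?_
  rw [tau_eq_zero π (by rw [Finset.mem_range] at hk; omega), pow_zero]

/-- The substitution `y_k ↦ y_k y_{k+1}`, the effect on the weights of adding an element that forms
an inversion with all others. -/
def consShift {R : Type*} [Mul R] (y : ℕ → R) (k : ℕ) : R := y k * y (k + 1)

theorem prod_tau_wrap {R : Type*} [CommSemiring R] (y : ℕ → R) {m : ℕ} (π : Equiv.Perm (Fin m)) :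
    ∏ k ∈ Finset.range (m + 2), y (k + 1) ^ tau (k + 1) (wrap π) =
      y 1 ^ 2 * y 2 *
        ∏ k ∈ Finset.range m, consShift (consShift y) (k + 1) ^ tau (k + 1) π := by
  have h1 : ∏ k ∈ Finset.range (m + 2), y (k + 1) ^ tau (k + 1) (wrap π) =
      y 1 ^ 2 * (∏ k ∈ Finset.range (m + 2), y (k + 1) ^ tau (k + 1) π) *
        (∏ k ∈ Finset.range (m + 1), y (k + 2) ^ tau (k + 1) π) ^ 2 *
        (∏ k ∈ Finset.range (m + 1), y (k + 2) ^ tau k π) := by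
    rw [Finset.prod_range_succ', Finset.prod_range_succ' _ (m + 1)]
    have hk : ∀ k, y (k + 2) ^ tau (k + 2) (wrap π) = y (k + 2) ^ tau (k + 2) π *
        (y (k + 2) ^ tau (k + 1) π) ^ 2 * y (k + 2) ^ tau k π := fun k => by
      rw [tau_wrap_add_two, pow_add, pow_add, pow_mul']
    simp only [add_assoc, Nat.reduceAdd, zero_add, hk, tau_wrap_one, pow_add (y 1),
      Finset.prod_mul_distrib, Finset.prod_pow]
    ring
  rw [h1, Finset.prod_range_succ' (fun k => y (k + 2) ^ tau k π) m, tau_zero,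
    ← prod_tau_eq y π (by omega : m ≤ m + 2),
    ← prod_tau_eq (fun k => y (k + 1)) π (by omega : m ≤ m + 1)]
  simp only [consShift, mul_pow, Finset.prod_mul_distrib, pow_one, zero_add, add_assoc,
    Nat.reduceAdd]
  ring

theorem tauWeight_empty (y : ℕ → MvPowerSeries σ ℚ) : tauWeight y emptyInv = 1 := by
  simp [tauWeight, emptyInv, signSeries_one]

theorem prod_tau_dirSum {R : Type*} [CommMonoid R] (y : ℕ → R) {m l : ℕ}
    (π : Equiv.Perm (Fin m)) (ρ : Equiv.Perm (Fin l)) :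
    ∏ k ∈ Finset.range (m + l), y (k + 1) ^ tau (k + 1) (dirSum π ρ) =
      (∏ k ∈ Finset.range m, y (k + 1) ^ tau (k + 1) π) *
        ∏ k ∈ Finset.range l, y (k + 1) ^ tau (k + 1) ρ := by
  rw [prod_tau_eq y π (by omega : m ≤ m + l), prod_tau_eq y ρ (by omega : l ≤ m + l)]
  simp only [tau_dirSum, pow_add, Finset.prod_mul_distrib]

theorem tauWeight_fixInv (y : ℕ → MvPowerSeries σ ℚ) (ρ : I3412) :
    tauWeight y (fixInv ρ) = y 1 * tauWeight y ρ := by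
  simp only [tauWeight, fixInv, prod_tau_dirSum, signSeries_dirSum, signSeries_one,
    Finset.prod_range_one, tau_one, zero_add, pow_one]
  ring

theorem tauWeight_wrapInv (y : ℕ → MvPowerSeries σ ℚ) (p : I3412 × I3412) :
    tauWeight y (wrapInv p) =
      -(y 1 ^ 2 * y 2) * (tauWeight (consShift (consShift y)) p.1 * tauWeight y p.2) := by
  simp only [tauWeight, wrapInv, prod_tau_dirSum, prod_tau_wrap, signSeries_dirSum,
    signSeries_wrap]
  ring

theorem formallySummable_tauWeight {y : ℕ → MvPowerSeries σ ℚ}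
    (hy : MvPowerSeries.constantCoeff (y 1) = 0) : FormallySummable (tauWeight y) := by
  refine formallySummable_of_le_order fun π => ?_
  rw [tauWeight, prod_tau_eq y π.1.2 (Nat.le_succ _), Finset.prod_range_succ', ← mul_assoc,
    zero_add, tau_one]
  exact le_order_mul_of_le_right (MvPowerSeries.le_order_pow_of_constantCoeff_eq_zero _ hy)

theorem constantCoeff_consShift_iterate {y : ℕ → MvPowerSeries σ ℚ}
    (hy : MvPowerSeries.constantCoeff (y 1) = 0) (n : ℕ) :
    MvPowerSeries.constantCoeff (consShift^[n] y 1) = 0 := by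
  induction n with
  | zero => exact hy
  | succ n ih => rw [Function.iterate_succ_apply', consShift, map_mul, ih, zero_mul]

/-- Each level of the continued fraction applies the substitution `consShift` twice. -/
theorem isContFrac_tauWeight {y a b : ℕ → MvPowerSeries σ ℚ}
    (hy : MvPowerSeries.constantCoeff (y 1) = 0) (ha0 : a 0 = 1)
    (ha : ∀ n, a (n + 1) = consShift^[2 * n] y 1 * consShift^[2 * n + 1] y 1)
    (hb : ∀ n, b n = 1 - consShift^[2 * n] y 1) :
    IsContFrac a b (formalSum (tauWeight y)) := by
  have hc := constantCoeff_consShift_iterate hy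
  refine isContFrac_of_recurrence (F := fun n => formalSum (tauWeight (consShift^[2 * n] y)))
    ha0 (fun n => ?_) (fun n => ?_) (fun n => ?_)
  · rw [ha, map_mul, hc, zero_mul]
  · rw [hb, map_sub, hc, map_one, sub_zero]
  · have e : consShift^[2 * (n + 1)] y = consShift (consShift (consShift^[2 * n] y)) := by
      rw [mul_add, mul_one, Function.iterate_succ_apply', Function.iterate_succ_apply']
    rw [ha, hb, Function.iterate_succ_apply', e]
    have h := formalSum_functional_equation (formallySummable_tauWeight (hc (2 * n)))
      (formallySummable_tauWeight (y := consShift (consShift (consShift^[2 * n] y)))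
        (by rw [← e]; exact hc _))
      (tauWeight_empty _) (tauWeight_fixInv _) (tauWeight_wrapInv _)
    refine Eq.trans ?_ h
    rw [consShift]
    ring

/-- Iterating `y_k ↦ y_k y_{k+1}` produces binomial exponents, by Pascal's rule. -/
theorem consShift_iterate_apply {R : Type*} [CommMonoid R] (y : ℕ → R) (n k : ℕ) :
    consShift^[n] y k = ∏ j ∈ Finset.range (n + 1), y (k + j) ^ n.choose j := by
  induction n generalizing k with
  | zero => simp
  | succ n ih =>
    rw [Function.iterate_succ_apply', consShift, ih, ih, Finset.prod_range_succ' _ (n + 1)]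
    simp only [Nat.choose_succ_succ', pow_add, Finset.prod_mul_distrib]
    rw [Finset.prod_range_succ (fun j => y (k + (j + 1)) ^ n.choose (j + 1)),
      Nat.choose_succ_self, pow_zero, mul_one, Finset.prod_range_succ' _ n]
    simp only [Nat.choose_zero_right, add_zero, add_assoc, add_comm 1]
    simp only [mul_comm, mul_left_comm]

theorem consShift_iterate_one {R : Type*} [CommMonoid R] (y : ℕ → R) {n N : ℕ} (h : n < N) :
    consShift^[n] y 1 = ∏ i ∈ Finset.Icc 1 N, y i ^ n.choose (i - 1) := by
  rw [consShift_iterate_apply, ← Finset.Ico_add_one_right_eq_Icc, Finset.prod_Ico_eq_prod_range,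
    Nat.add_sub_cancel]
  simp only [Nat.add_sub_cancel_left]
  refine Finset.prod_subset (Finset.range_mono h) fun j _ hj => ?_
  rw [Nat.choose_eq_zero_of_lt (by rw [Finset.mem_range] at hj; omega), pow_zero]

theorem tauTerm_eq_tauWeight : tauTerm = tauWeight MvPowerSeries.X := by
  funext π
  rw [tauTerm, tauWeight, ← Finset.Ico_add_one_right_eq_Icc, Finset.prod_Ico_eq_prod_range,
    Nat.add_sub_cancel]
  simp only [add_comm 1]

/-- The weights for which `∏_k y_k ^ τ_k(π) = x ^ |π| q ^ inv(π)`. -/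
noncomputable def invWeight (k : ℕ) : MvPowerSeries (Fin 2) ℚ :=
  if k = 1 then xVar else if k = 2 then qVar else 1

theorem statTerm_numInv_eq_tauWeight : statTerm numInv = tauWeight invWeight := by
  funext π
  rw [statTerm, tauWeight, prod_tau_eq _ _ (Nat.le_add_right _ 2), Finset.prod_range_succ',
    Finset.prod_range_succ', Finset.prod_eq_one fun k _ => by simp [invWeight]]
  simp only [invWeight, tau_one, tau_two, zero_add, if_true, one_mul, Nat.reduceAdd,
    OfNat.ofNat_ne_one, if_false]
  ring

theorem consShift_iterate_invWeight (n : ℕ) :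
    consShift^[n] invWeight 1 = xVar * qVar ^ n := by
  rw [consShift_iterate_one invWeight (by omega : n < n + 2),
    ← Finset.Ico_add_one_right_eq_Icc, Finset.prod_Ico_eq_prod_range, Nat.add_sub_cancel,
    Finset.prod_range_succ', Finset.prod_range_succ',
    Finset.prod_eq_one fun k _ => by simp [invWeight, show 1 + (k + 1 + 1) ≠ 2 by omega]]
  simp [invWeight, mul_comm]

end TauWeights

/-! ### Extrema and fixed points -/

section StatTerms

theorem formallySummable_statTerm (stat : ∀ {n : ℕ}, Equiv.Perm (Fin n) → ℕ) :
    FormallySummable (statTerm stat) :=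
  formallySummable_of_le_order fun _ =>
    le_order_mul_of_le_right
      (MvPowerSeries.le_order_pow_of_constantCoeff_eq_zero _ (MvPowerSeries.constantCoeff_X _))

/-- The functional equation for a statistic that is additive on direct sums, has the value `s` on
the permutation `1`, and is given on wrapped permutations by another statistic. -/
theorem formalSum_statTerm (stat stat' : ∀ {n : ℕ}, Equiv.Perm (Fin n) → ℕ) (s c : ℕ)
    (h0 : stat (1 : Equiv.Perm (Fin 0)) = 0) (h1 : stat (1 : Equiv.Perm (Fin 1)) = s)
    (hadd : ∀ {m l : ℕ} (π : Equiv.Perm (Fin m)) (ρ : Equiv.Perm (Fin l)),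
      stat (dirSum π ρ) = stat π + stat ρ)
    (hwrap : ∀ {m : ℕ} (π : Equiv.Perm (Fin m)), stat (wrap π) = c + stat' π) :
    formalSum (statTerm stat) *
      (1 - xVar * qVar ^ s + xVar ^ 2 * qVar ^ c * formalSum (statTerm stat')) = 1 := by
  refine formalSum_functional_equation (formallySummable_statTerm _) (formallySummable_statTerm _)
    ?_ (fun ρ => ?_) (fun p => ?_)
  · simp only [statTerm, emptyInv, signSeries_one, h0, pow_zero, one_mul]
  · simp only [statTerm, fixInv, signSeries_dirSum, signSeries_one, hadd, h1]
    ring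
  · simp only [statTerm, wrapInv, signSeries_dirSum, signSeries_wrap, hadd, hwrap]
    ring

theorem formalSum_statTerm_zero :
    formalSum (statTerm fun _ => 0) *
      (1 - xVar + xVar ^ 2 * formalSum (statTerm fun _ => 0)) = 1 := by
  simpa using formalSum_statTerm (fun _ => 0) (fun _ => 0) 0 0 rfl rfl (fun _ _ => rfl)
    (fun _ => rfl)

theorem formalSum_statTerm_lrmax :
    formalSum (statTerm lrmax) *
      (1 - xVar * qVar + xVar ^ 2 * qVar * formalSum (statTerm fun _ => 0)) = 1 := by
  simpa using formalSum_statTerm lrmax (fun _ => 0) 1 1 rfl rfl lrmax_dirSum lrmax_wrap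

theorem formalSum_statTerm_rlmin :
    formalSum (statTerm rlmin) *
      (1 - xVar * qVar + xVar ^ 2 * qVar * formalSum (statTerm fun _ => 0)) = 1 := by
  simpa using formalSum_statTerm rlmin (fun _ => 0) 1 1 rfl rfl rlmin_dirSum rlmin_wrap

theorem formalSum_statTerm_numFix :
    formalSum (statTerm numFix) *
      (1 - xVar * qVar + xVar ^ 2 * formalSum (statTerm numFix)) = 1 := by
  simpa using formalSum_statTerm numFix numFix 1 0 rfl rfl numFix_dirSum
    (fun π => by rw [numFix_wrap, zero_add])

/-- Completing the square in the quadratic equation `F (1 - u + x² F) = 1`. -/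
theorem isFormalSqrt_of_quadratic {u F : MvPowerSeries (Fin 2) ℚ}
    (hu : MvPowerSeries.constantCoeff u = 0) (hF : F * (1 - u + xVar ^ 2 * F) = 1) :
    IsFormalSqrt ((1 - u) ^ 2 + 4 * xVar ^ 2) (2 * xVar ^ 2 * F + 1 - u) := by
  constructor
  · simp [hu]
  · linear_combination 4 * xVar ^ 2 * hF

end StatTerms

/-! ### The continued fractions and closed forms -/

theorem mainTheorem2 :
    -- the multivariate continued fraction
    (FormallySummable tauTerm ∧
      IsContFrac
        (fun n => if n = 0 then 1 else
          ∏ i ∈ Finset.Icc 1 (2 * n), (MvPowerSeries.X i : MvPowerSeries ℕ ℚ) ^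
            (Nat.choose (2 * n - 2) (i - 1) + Nat.choose (2 * n - 1) (i - 1)))
        (fun n => 1 - ∏ i ∈ Finset.Icc 1 (2 * n + 1), (MvPowerSeries.X i : MvPowerSeries ℕ ℚ) ^
          Nat.choose (2 * n) (i - 1))
        (formalSum tauTerm)) ∧
    -- inversions
    (FormallySummable (statTerm numInv) ∧
      IsContFrac
        (fun n => if n = 0 then 1 else xVar ^ 2 * qVar ^ (4 * n - 3))
        (fun n => 1 - xVar * qVar ^ (2 * n))
        (formalSum (statTerm numInv))) ∧
    -- left-to-right maxima and right-to-left minima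
    (FormallySummable (statTerm lrmax) ∧ FormallySummable (statTerm rlmin) ∧
      formalSum (statTerm lrmax) = formalSum (statTerm rlmin) ∧
      IsContFrac
        (fun n => if n = 0 then 1 else if n = 1 then xVar ^ 2 * qVar else xVar ^ 2)
        (fun n => if n = 0 then 1 - xVar * qVar else 1 - xVar)
        (formalSum (statTerm lrmax)) ∧
      ∃ S, IsFormalSqrt (1 - 2 * xVar + 5 * xVar ^ 2) S ∧
        formalSum (statTerm lrmax) = 2 * (2 - qVar - qVar * xVar + qVar * S)⁻¹) ∧
    -- fixed points
    (FormallySummable (statTerm numFix) ∧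
      IsContFrac
        (fun n => if n = 0 then 1 else xVar ^ 2)
        (fun _ => 1 - xVar * qVar)
        (formalSum (statTerm numFix)) ∧
      ∃ S, IsFormalSqrt (1 - 2 * xVar * qVar + xVar ^ 2 * qVar ^ 2 + 4 * xVar ^ 2) S ∧
        2 * xVar ^ 2 * formalSum (statTerm numFix) = -1 + xVar * qVar + S) := by

  have hx : MvPowerSeries.constantCoeff xVar = 0 := MvPowerSeries.constantCoeff_X 0
  have hX : MvPowerSeries.constantCoeff (MvPowerSeries.X 1 : MvPowerSeries ℕ ℚ) = 0 :=
    MvPowerSeries.constantCoeff_X 1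
  have hinv : MvPowerSeries.constantCoeff (invWeight 1) = 0 := hx
  refine ⟨⟨?_, ?_⟩, ⟨?_, ?_⟩,
    ⟨formallySummable_statTerm _, formallySummable_statTerm _, ?_, ?_, ?_⟩,
    formallySummable_statTerm _, ?_, ?_⟩
  · rw [tauTerm_eq_tauWeight]
    exact formallySummable_tauWeight hX
  · rw [tauTerm_eq_tauWeight]
    refine isContFrac_tauWeight hX (if_pos rfl) (fun n => ?_) (fun n => ?_)
    · rw [if_neg n.succ_ne_zero, consShift_iterate_one _ (by omega : 2 * n < 2 * (n + 1)),
        consShift_iterate_one _ (by omega : 2 * n + 1 < 2 * (n + 1)), ← Finset.prod_mul_distrib]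
      refine Finset.prod_congr rfl fun i _ => ?_
      rw [← pow_add, show 2 * (n + 1) - 2 = 2 * n by omega,
        show 2 * (n + 1) - 1 = 2 * n + 1 by omega]
    · rw [consShift_iterate_one _ (Nat.lt_succ_self _)]
  · exact formallySummable_statTerm _
  · rw [statTerm_numInv_eq_tauWeight]
    refine isContFrac_tauWeight hinv (if_pos rfl) (fun n => ?_) (fun n => ?_)
    · rw [if_neg n.succ_ne_zero, consShift_iterate_invWeight, consShift_iterate_invWeight,
        show 4 * (n + 1) - 3 = 2 * n + (2 * n + 1) by omega]
      ring
    · rw [consShift_iterate_invWeight]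
  · refine mul_right_cancel₀ (right_ne_zero_of_mul_eq_one formalSum_statTerm_lrmax) ?_
    rw [formalSum_statTerm_lrmax, formalSum_statTerm_rlmin]
  · refine isContFrac_of_recurrence
      (F := fun n => if n = 0 then formalSum (statTerm lrmax) else formalSum (statTerm fun _ => 0))
      (if_pos rfl) (fun n => ?_) (fun n => ?_) (fun n => ?_)
    · cases n <;> simp [hx]
    · cases n <;> simp [hx]
    · cases n with
      | zero => simpa using formalSum_statTerm_lrmax
      | succ n => simpa using formalSum_statTerm_zero
  · have h := isFormalSqrt_of_quadratic hx formalSum_statTerm_zero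
    refine ⟨_, by convert h using 1; ring, ?_⟩
    rw [MvPowerSeries.eq_mul_inv_iff_mul_eq]
    · linear_combination 2 * formalSum_statTerm_lrmax
    · have h2 : MvPowerSeries.constantCoeff (2 : MvPowerSeries (Fin 2) ℚ) = 2 := map_ofNat _ 2
      simp [hx, h2]
  · refine isContFrac_of_recurrence (F := fun _ => formalSum (statTerm numFix))
      (if_pos rfl) (fun n => ?_) (fun n => ?_) (fun n => ?_)
    · simp [hx]
    · simp [hx]
    · simpa using formalSum_statTerm_numFix
  · have h := isFormalSqrt_of_quadratic (by simp [hx]) formalSum_statTerm_numFix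
    refine ⟨_, by convert h using 1; ring, ?_⟩
    ring
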